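/- For real $\varepsilon$ let $G^\varepsilon$ be the subgroup of $GL_2(\mathbb R)$ generated by $g_1^{\varepsilon}=\begin{pmatrix} e^{\varepsilon} & 0\\ 0& 1\end{pmatrix}$, $g_2^{\varepsilon}=\begin{pmatrix} 1 & \varepsilon\\ 0& 1\end{pmatrix}$ (and their inverses), with unit element $e=I_2$. Let $(X_i)_{i\ge1}$ and $(Y_i)_{i\ge 1}$ be two independent sequences of independent random variables on a probability space $(\Omega,\mathcal A,\mathbb P)$ with $\mathbb P[X_i=1]=\mathbb P[X_i=-1]=\mathbb P[Y_i=1]=\mathbb P[Y_i=-1]=\tfrac12$, and define the Bernoulli random walk by $$x_0^\varepsilon=e,\qquad x_{n+1}^\varepsilon=x_n^\varepsilon\begin{pmatrix} e^{\varepsilon X_{n+1}} & \varepsilon Y_{n+1}\\ 0& 1\end{pmatrix}\quad(n\ge 0),\qquad \pi_{2n}=\mathbb P[x_{2n}^\varepsilon=e].$$ **Proposition.** There exist a real number $c\ge 1$ and an integer $N$ such that for every real $\varepsilon$ for which the number $e^{\varepsilon}$ is transcendental, and all such sequences $(X_i)$, $(Y_i)$, the walk almost surely stays in $G^\varepsilon$,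 and $$\pi_{2n}\le \exp\bigl(-c^{-1}n^{1/3}(\ln n)^{2/3}\bigr)\qquad\text{for all integers } n\ge N.$$ In particular $c$ and $N$ do not depend on $\varepsilon$. -/

import Mathlib

open MeasureTheory ProbabilityTheory

noncomputable section

/-- The element of the affine group of the real line with matrix `[[exp s, b], [0, 1]]`,
as an invertible real `2 × 2` matrix. -/
def affElt (s b : ℝ) : GL (Fin 2) ℝ :=
  Matrix.GeneralLinearGroup.mkOfDetNeZero !![Real.exp s, b; 0, 1]
    (by simp [Matrix.det_fin_two])

/-- The subgroup generated by the dilation `[[exp ε, 0], [0, 1]]`, the translation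
`[[1, ε], [0, 1]]` and their inverses. -/
def affSubgroup (ε : ℝ) : Subgroup (GL (Fin 2) ℝ) :=
  Subgroup.closure {affElt ε 0, affElt 0 ε}

/-- `X` and `Y` are independent sequences of independent symmetric `±1` random variables:
all the variables `X i` and `Y j` together are mutually independent. -/
structure IsBernoulliPair {Ω : Type*} [MeasurableSpace Ω] (P : Measure Ω)
    (X Y : ℕ → Ω → ℝ) : Prop where
  measurable_X : ∀ i, Measurable (X i)
  measurable_Y : ∀ i, Measurable (Y i)
  indep : iIndepFun (Sum.elim X Y) P
  X_pos : ∀ i, P {ω | X i ω = 1} = 1 / 2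
  X_neg : ∀ i, P {ω | X i ω = -1} = 1 / 2
  Y_pos : ∀ i, P {ω | Y i ω = 1} = 1 / 2
  Y_neg : ∀ i, P {ω | Y i ω = -1} = 1 / 2

/-- The walk `x 0 = e`, `x (n + 1) = x n * [[exp (ε X), ε Y], [0, 1]]`. The innovations are
numbered from `0`: `X n`, `Y n` are those used in the step from time `n` to time `n + 1`. -/
def affWalk {Ω : Type*} (ε : ℝ) (X Y : ℕ → Ω → ℝ) : ℕ → Ω → GL (Fin 2) ℝ
  | 0, _ => 1
  | n + 1, ω => affWalk ε X Y n ω * affElt (ε * X n ω) (ε * Y n ω)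

/-- The probability that the walk is at the identity at time `n`. -/
def returnProb {Ω : Type*} [MeasurableSpace Ω] (P : Measure Ω) (ε : ℝ)
    (X Y : ℕ → Ω → ℝ) (n : ℕ) : ℝ :=
  P.real {ω | affWalk ε X Y n ω = 1}

end

/-! Put `t = exp ε`. The translation entry of the walk at time `N` is `ε ∑ Y_k t ^ S_k`, where `S`
is the simple random walk driven by `X`. If the walk returns to the identity, this Laurent
polynomial in `t` with integer coefficients vanishes. Transcendence then kills each coefficient: at
every site visited by `S` the signs `Y` used there sum to zero (`siteSumsVanish_of_affWalk_eq_one`).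
This leaves a counting problem free of `ε`, whence the uniformity.

Given the path, the conditions at distinct sites are independent, and a site with local time `L`
contributes a factor at most `(L + 1) ^ (-1/2)` (`card_fiber_sums_eq_zero_le`). With probability at
least `1/2`, a path of length `R²` visits at least `R/64` sites at least `R/36` times each
(`card_not_manyHeavySites_le`): it spends most of its time within distance `4R`, and by
Cauchy–Schwarz its `O(R³)` self-intersections prevent that time from concentrating on few sites.
Cutting time `2n` into about `2n/R²` independent blocks bounds the return probability by `2 ^
(-⌊2n/R²⌋) + (R/36) ^ (-R/128)` (`card_pairs_siteSumsVanish_le`). The exponents `n/R²` and `R log R`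
balance at `R ≈ (n / log n) ^ (1/3)`, and both are then of order `n ^ (1/3) (log n) ^ (2/3)`. -/

/-! ### Sign sequences -/

/-- The sign `±1` encoded by a Boolean. -/
def boolSign (b : Bool) : ℤ := if b then 1 else -1

theorem boolSign_not (b : Bool) : boolSign (!b) = -boolSign b := by cases b <;> simp [boolSign]

theorem boolSign_sq (b : Bool) : boolSign b ^ 2 = 1 := by cases b <;> simp [boolSign]

/-- An explicit form of the `m ^ (-1/2)` decay of the return probability of simple random walk. The
induction closes because `(2m+1)(2m+3) ≤ 4(m+1)²`. -/
theorem centralBinom_sq_mul_le (m : ℕ) : m.centralBinom ^ 2 * (2 * m + 1) ≤ 16 ^ m := by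
  induction m with
  | zero => simp
  | succ m ih =>
    have h := Nat.succ_mul_centralBinom_succ m
    refine le_of_mul_le_mul_left (a := (m + 1) ^ 2) ?_ (pow_pos m.succ_pos 2)
    calc (m + 1) ^ 2 * ((m + 1).centralBinom ^ 2 * (2 * (m + 1) + 1))
        = ((m + 1) * (m + 1).centralBinom) ^ 2 * (2 * m + 3) := by ring
      _ = 4 * ((2 * m + 1) * (2 * m + 3)) * (m.centralBinom ^ 2 * (2 * m + 1)) := by
        rw [h]; ring
      _ ≤ 4 * ((2 * m + 1) * (2 * m + 3)) * 16 ^ m := by gcongr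
      _ ≤ 4 * (4 * (m + 1) ^ 2) * 16 ^ m :=
        Nat.mul_le_mul_right _ (Nat.mul_le_mul_left _ (by nlinarith))
      _ = (m + 1) ^ 2 * 16 ^ (m + 1) := by ring

theorem sum_boolSign_eq {α : Type*} [Fintype α] (z : α → Bool) :
    ∑ i, boolSign (z i) = 2 * (Finset.univ.filter fun i => z i = true).card - Fintype.card α := by
  have h : ∀ i, boolSign (z i) = 2 * (if z i = true then 1 else 0) - 1 := by
    intro i; cases z i <;> simp [boolSign]
  simp only [h, Finset.sum_sub_distrib, ← Finset.mul_sum]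
  simp

theorem card_sum_boolSign_eq_zero_le (α : Type*) [Fintype α] [DecidableEq α] :
    ((Finset.univ.filter fun z : α → Bool => ∑ i, boolSign (z i) = 0).card : ℝ) ≤
      2 ^ Fintype.card α / √(Fintype.card α + 1) := by
  have hpos : (0 : ℝ) < √(Fintype.card α + 1) := by positivity
  rcases Nat.even_or_odd' (Fintype.card α) with ⟨m, hm | hm⟩
  · have hle : (Finset.univ.filter fun z : α → Bool => ∑ i, boolSign (z i) = 0).card ≤
        m.centralBinom := by
      have : m.centralBinom = (Finset.powersetCard m (Finset.univ : Finset α)).card := by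
        rw [Finset.card_powersetCard, Finset.card_univ, hm, Nat.centralBinom]
      rw [this]
      -- A zero-sum sign sequence of length `2m` is determined by its `m` plus signs.
      refine Finset.card_le_card_of_injOn (fun z => Finset.univ.filter fun i => z i = true) ?_ ?_
      · intro z hz
        have hz' : ∑ i, boolSign (z i) = 0 := by simpa using hz
        rw [sum_boolSign_eq, hm] at hz'
        simp only [Finset.mem_powersetCard, Finset.mem_coe]
        refine ⟨Finset.subset_univ _, ?_⟩
        push_cast at hz'
        omega
      · intro z _ w _ h
        funext i
        have := Finset.ext_iff.1 h i
        simp only [Finset.mem_filter, Finset.mem_univ, true_and] at this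
        exact Bool.eq_iff_iff.2 this
    rw [le_div_iff₀ hpos]
    have h2 : ((m.centralBinom : ℝ)) * √(Fintype.card α + 1) ≤ 2 ^ Fintype.card α := by
      refine le_of_sq_le_sq ?_ (by positivity)
      rw [mul_pow, Real.sq_sqrt (by positivity), hm]
      have := centralBinom_sq_mul_le m
      calc (m.centralBinom : ℝ) ^ 2 * (((2 * m : ℕ) : ℝ) + 1)
          = ((m.centralBinom ^ 2 * (2 * m + 1) : ℕ) : ℝ) := by push_cast; ring
        _ ≤ ((16 ^ m : ℕ) : ℝ) := by exact_mod_cast this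
        _ = (2 ^ (2 * m)) ^ 2 := by
          rw [← pow_mul, mul_right_comm, pow_mul]; norm_num
    refine le_trans ?_ h2
    gcongr
  · rw [Finset.card_eq_zero.2]
    · simp only [Nat.cast_zero]; positivity
    · refine Finset.filter_eq_empty_iff.2 fun z _ hz => ?_
      rw [sum_boolSign_eq, hm] at hz
      push_cast at hz
      omega

theorem card_sum_boolSign_subset_eq_zero_le {ι : Type*} [Fintype ι] [DecidableEq ι]
    (A : Finset ι) :
    ((Finset.univ.filter fun z : ι → Bool => ∑ i ∈ A, boolSign (z i) = 0).card : ℝ) ≤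
      2 ^ Fintype.card ι / √(A.card + 1) := by
  set Z := Finset.univ.filter fun z : A → Bool => ∑ i, boolSign (z i) = 0
  have hle : (Finset.univ.filter fun z : ι → Bool => ∑ i ∈ A, boolSign (z i) = 0).card ≤
      (Z ×ˢ (Finset.univ : Finset ({i // i ∉ A} → Bool))).card := by
    refine Finset.card_le_card_of_injOn (fun z => (fun i => z i, fun i => z i)) ?_ ?_
    · intro z hz
      have hz' : ∑ i ∈ A, boolSign (z i) = 0 := by simpa using hz
      simp only [Finset.coe_product, Set.mem_prod, Finset.mem_coe, Finset.mem_univ, and_true, Z,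
        Finset.mem_filter, true_and]
      rw [← hz', ← Finset.sum_coe_sort A]
    · intro z _ w _ h
      simp only [Prod.mk.injEq, funext_iff] at h
      funext i
      by_cases hi : i ∈ A
      · exact h.1 ⟨i, hi⟩
      · exact h.2 ⟨i, hi⟩
  have hZ := card_sum_boolSign_eq_zero_le A
  have hc : Fintype.card {i // i ∉ A} = Fintype.card ι - A.card := by
    rw [Fintype.card_subtype_compl]; simp
  have hAc : A.card ≤ Fintype.card ι := Finset.card_le_univ A
  rw [Finset.card_product, Finset.card_univ, Fintype.card_fun, Fintype.card_bool, hc] at hle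
  rw [Fintype.card_coe] at hZ
  calc _ ≤ ((Z.card * 2 ^ (Fintype.card ι - A.card) : ℕ) : ℝ) := by exact_mod_cast hle
    _ = (Z.card : ℝ) * 2 ^ (Fintype.card ι - A.card) := by push_cast; ring
    _ ≤ (2 ^ A.card / √(A.card + 1)) * 2 ^ (Fintype.card ι - A.card) := by gcongr
    _ = _ := by
      rw [div_mul_eq_mul_div, ← pow_add, Nat.add_sub_cancel' hAc]

/-- The fibres of `f` partition the coordinates, so the constraints are independent and the count
factors over the fibres. -/
theorem card_fiber_sums_eq_zero_le {ι κ : Type*} [Fintype ι] [DecidableEq ι] [DecidableEq κ]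
    (f : ι → κ) :
    ((Finset.univ.filter fun z : ι → Bool =>
        ∀ k, ∑ i with f i = f k, boolSign (z i) = 0).card : ℝ) ≤
      2 ^ Fintype.card ι *
        ∏ j ∈ Finset.univ.image f, (√((Finset.univ.filter fun i => f i = j).card + 1))⁻¹ := by
  set J := Finset.univ.image f
  let Z : ∀ j : J, Finset ({i // f i = j} → Bool) := fun j =>
    Finset.univ.filter fun z => ∑ i, boolSign (z i) = 0
  have hle : (Finset.univ.filter fun z : ι → Bool =>
      ∀ k, ∑ i with f i = f k, boolSign (z i) = 0).card ≤ (Fintype.piFinset Z).card := by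
    refine Finset.card_le_card_of_injOn (fun z j i => z i) ?_ ?_
    · intro z hz
      have hz' : ∀ k, ∑ i with f i = f k, boolSign (z i) = 0 := by simpa using hz
      simp only [Finset.mem_coe, Fintype.mem_piFinset, Z, Finset.mem_filter, Finset.mem_univ,
        true_and]
      rintro ⟨j, hj⟩
      obtain ⟨k, -, rfl⟩ := Finset.mem_image.1 hj
      rw [← hz' k]
      exact (Finset.sum_subtype _ (by simp) fun i => boolSign (z i)).symm
    · intro z _ w _ h
      funext i
      exact congrFun (congrFun h ⟨f i, Finset.mem_image_of_mem f (Finset.mem_univ i)⟩) ⟨i, rfl⟩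
  rw [Fintype.card_piFinset] at hle
  have hcard : Fintype.card ι = ∑ j ∈ J, (Finset.univ.filter fun i => f i = j).card :=
    Finset.card_eq_sum_card_image f Finset.univ
  calc _ ≤ ((∏ j : J, (Z j).card : ℕ) : ℝ) := by exact_mod_cast hle
    _ = ∏ j : J, ((Z j).card : ℝ) := by push_cast; rfl
    _ ≤ ∏ j : J, (2 ^ (Finset.univ.filter fun i => f i = j).card *
          (√((Finset.univ.filter fun i => f i = j).card + 1))⁻¹) := by
      refine Finset.prod_le_prod (fun _ _ => by positivity) fun j _ => ?_
      have := card_sum_boolSign_eq_zero_le {i // f i = j}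
      rw [Fintype.card_subtype] at this
      rw [← div_eq_mul_inv]
      exact this
    _ = ∏ j ∈ J, (2 ^ (Finset.univ.filter fun i => f i = j).card *
          (√((Finset.univ.filter fun i => f i = j).card + 1))⁻¹) :=
      Finset.prod_coe_sort J fun j => (2 ^ (Finset.univ.filter fun i => f i = j).card *
          (√((Finset.univ.filter fun i => f i = j).card + 1))⁻¹ : ℝ)
    _ = _ := by rw [Finset.prod_mul_distrib, Finset.prod_pow_eq_pow_sum, ← hcard]

theorem sum_sq_sum_boolSign {ι : Type*} [Fintype ι] [DecidableEq ι] (A : Finset ι) :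
    ∑ z : ι → Bool, (∑ i ∈ A, boolSign (z i)) ^ 2 = 2 ^ Fintype.card ι * A.card := by
  induction A using Finset.induction_on with
  | empty => simp
  | insert a A ha ih =>
    -- Flipping the sign at `a` pairs off the cross terms: distinct coordinates are orthogonal.
    have hcross : ∑ z : ι → Bool, boolSign (z a) * ∑ i ∈ A, boolSign (z i) = 0 := by
      refine Finset.sum_involution (fun z _ => Function.update z a (!z a)) ?_ ?_ ?_ ?_
      · intro z _
        have : ∑ i ∈ A, boolSign (Function.update z a (!z a) i) = ∑ i ∈ A, boolSign (z i) := by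
          refine Finset.sum_congr rfl fun i hi => ?_
          rw [Function.update_of_ne (ne_of_mem_of_not_mem hi ha)]
        rw [this, Function.update_self, boolSign_not]
        ring
      · intro z _ _ h
        have := congrFun h a
        simp at this
      · simp
      · intro z _; simp
    simp only [Finset.sum_insert ha, Finset.card_insert_of_notMem ha, add_sq, boolSign_sq,
      Finset.sum_add_distrib, ih, mul_assoc]
    rw [← Finset.mul_sum, hcross]
    simp
    ring

/-! ### Simple random walk paths and their local times -/

/-- The `j`-th increment of the path encoded by `x`, extended by `0`. -/
def pathStep {N : ℕ} (x : Fin N → Bool) (j : ℕ) : ℤ := if h : j < N then boolSign (x ⟨j, h⟩) else 0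

/-- The position at time `i` of the path encoded by `x`. -/
def pathPos {N : ℕ} (x : Fin N → Bool) (i : ℕ) : ℤ := ∑ j ∈ Finset.range i, pathStep x j

/-- The number of times before `N` spent at the site `j`. -/
def localTime {N : ℕ} (x : Fin N → Bool) (j : ℤ) : ℕ :=
  (Finset.univ.filter fun i : Fin N => pathPos x i = j).card

theorem sum_pathStep_eq {N : ℕ} (x : Fin N → Bool) (s : Finset ℕ) (hs : ∀ i ∈ s, i < N) :
    ∑ j ∈ s, pathStep x j = ∑ i ∈ s.attachFin hs, boolSign (x i) := by
  conv_lhs => rw [← Finset.map_valEmbedding_attachFin hs, Finset.sum_map]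
  refine Finset.sum_congr rfl fun i _ => ?_
  simp [pathStep]

theorem pathPos_sub {N : ℕ} (x : Fin N → Bool) {a b : ℕ} (h : a ≤ b) :
    pathPos x b - pathPos x a = ∑ j ∈ Finset.Ico a b, pathStep x j :=
  (Finset.sum_Ico_eq_sub _ h).symm

theorem card_pathPos_eq_le_of_le {N a b : ℕ} (hab : a ≤ b) (hb : b ≤ N) :
    ((Finset.univ.filter fun x : Fin N → Bool => pathPos x a = pathPos x b).card : ℝ) ≤
      2 ^ N / √((b - a : ℕ) + 1) := by
  have hs : ∀ i ∈ Finset.Ico a b, i < N := fun i hi => (Finset.mem_Ico.1 hi).2.trans_le hb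
  have := card_sum_boolSign_subset_eq_zero_le ((Finset.Ico a b).attachFin hs)
  rw [Finset.card_attachFin, Nat.card_Ico, Fintype.card_fin] at this
  refine le_trans (le_of_eq ?_) this
  congr 2
  refine Finset.filter_congr fun x _ => ?_
  rw [← sum_pathStep_eq x _ hs, ← pathPos_sub x hab, sub_eq_zero, eq_comm]

theorem card_pathPos_eq_le {N a b : ℕ} (ha : a ≤ N) (hb : b ≤ N) :
    ((Finset.univ.filter fun x : Fin N → Bool => pathPos x a = pathPos x b).card : ℝ) ≤
      2 ^ N * (√(Nat.dist a b + 1))⁻¹ := by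
  rw [← div_eq_mul_inv]
  rcases le_total a b with h | h
  · rw [Nat.dist_eq_sub_of_le h]
    exact card_pathPos_eq_le_of_le h hb
  · rw [Nat.dist_eq_sub_of_le_right h]
    simpa only [eq_comm] using card_pathPos_eq_le_of_le h ha

theorem sum_sq_pathPos {N a : ℕ} (ha : a ≤ N) :
    ∑ x : Fin N → Bool, pathPos x a ^ 2 = 2 ^ N * a := by
  have hs : ∀ i ∈ Finset.range a, i < N := fun i hi => (Finset.mem_range.1 hi).trans_le ha
  have := sum_sq_sum_boolSign ((Finset.range a).attachFin hs)
  rw [Finset.card_attachFin, Finset.card_range, Fintype.card_fin] at this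
  rw [← this]
  refine Finset.sum_congr rfl fun x _ => ?_
  rw [← sum_pathStep_eq x _ hs, pathPos]

theorem sum_inv_sqrt_le (T : ℕ) : ∑ m ∈ Finset.range T, (√((m : ℝ) + 1))⁻¹ ≤ 2 * √T := by
  induction T with
  | zero => simp
  | succ T ih =>
    rw [Finset.sum_range_succ]
    have h0 : 0 ≤ √(T : ℝ) := Real.sqrt_nonneg _
    have h1 : 0 < √((T : ℝ) + 1) := by positivity
    have e0 : √(T : ℝ) ^ 2 = T := Real.sq_sqrt (by positivity)
    have e1 : √((T : ℝ) + 1) ^ 2 = T + 1 := Real.sq_sqrt (by positivity)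
    have : (√((T : ℝ) + 1))⁻¹ ≤ 2 * (√((T : ℝ) + 1) - √T) := by
      rw [inv_le_iff_one_le_mul₀ h1]
      nlinarith [sq_nonneg (√((T : ℝ) + 1) - √T)]
    push_cast
    linarith

theorem sum_comp_le_sum_range {g : ℕ → ℝ} (hg : ∀ m, 0 ≤ g m) {T : ℕ} {s : Finset ℕ} {e : ℕ → ℕ}
    (he : Set.InjOn e s) (hmem : ∀ b ∈ s, e b < T) :
    ∑ b ∈ s, g (e b) ≤ ∑ m ∈ Finset.range T, g m := by
  rw [← Finset.sum_image he]
  refine Finset.sum_le_sum_of_subset_of_nonneg ?_ fun i _ _ => hg i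
  intro m hm
  obtain ⟨b, hb, rfl⟩ := Finset.mem_image.1 hm
  exact Finset.mem_range.2 (hmem b hb)

theorem sum_dist_le {g : ℕ → ℝ} (hg : ∀ m, 0 ≤ g m) {T a : ℕ} (ha : a < T) :
    ∑ b ∈ Finset.range T, g (Nat.dist a b) ≤ 2 * ∑ m ∈ Finset.range T, g m := by
  -- Each distance from `a` occurs at most once on either side; `b = a` is counted twice, which is
  -- harmless since `g ≥ 0`.
  have h : ∀ b ∈ Finset.range T, g (Nat.dist a b) ≤
      (if b ≤ a then g (a - b) else 0) + (if a ≤ b then g (b - a) else 0) := by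
    intro b _
    rcases lt_trichotomy a b with h | h | h
    · rw [Nat.dist_eq_sub_of_le h.le, if_neg h.not_ge, if_pos h.le, zero_add]
    · subst h; simp [hg]
    · rw [Nat.dist_eq_sub_of_le_right h.le, if_pos h.le, if_neg h.not_ge, add_zero]
  refine (Finset.sum_le_sum h).trans ?_
  rw [Finset.sum_add_distrib, two_mul, ← Finset.sum_filter, ← Finset.sum_filter]
  gcongr
  · refine sum_comp_le_sum_range hg ?_ ?_
    · intro b hb c hc h
      simp only [Finset.coe_filter, Finset.mem_range, Set.mem_ofPred_eq] at hb hc h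
      omega
    · intro b hb
      simp only [Finset.mem_filter, Finset.mem_range] at hb
      omega
  · refine sum_comp_le_sum_range hg ?_ ?_
    · intro b hb c hc h
      simp only [Finset.coe_filter, Finset.mem_range, Set.mem_ofPred_eq] at hb hc h
      omega
    · intro b hb
      simp only [Finset.mem_filter, Finset.mem_range] at hb
      omega

/-- The number of pairs of times before `N` at which the path is at the same site. -/
def selfIntersections {N : ℕ} (x : Fin N → Bool) : ℕ := ∑ i : Fin N, localTime x (pathPos x i)

/-- Times `a` and `b` share a site with probability at most `(|a - b| + 1) ^ (-1/2)`. Summing over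
`b` gives at most `4R`, and there are `R²` choices of `a`. -/
theorem sum_selfIntersections_le (R : ℕ) :
    ∑ x : Fin (R * R) → Bool, (selfIntersections x : ℝ) ≤ 2 ^ (R * R) * (4 * (R : ℝ) ^ 3) := by
  set T := R * R
  have hsqrt : √(T : ℝ) = R := by simp [T]
  have h1 : ∑ x : Fin T → Bool, (selfIntersections x : ℝ) =
      ∑ a : Fin T, ∑ b : Fin T,
        ((Finset.univ.filter fun x : Fin T → Bool => pathPos x a = pathPos x b).card : ℝ) := by
    simp only [selfIntersections, localTime, Finset.card_filter, Nat.cast_sum]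
    rw [Finset.sum_comm]
    refine Finset.sum_congr rfl fun a _ => ?_
    rw [Finset.sum_comm]
    refine Finset.sum_congr rfl fun b _ => Finset.sum_congr rfl fun x _ => ?_
    simp only [eq_comm]
  rw [h1]
  calc _ ≤ ∑ a : Fin T, ∑ b : Fin T, (2 : ℝ) ^ T * (√(Nat.dist a b + 1))⁻¹ := by
        gcongr with a _ b _
        exact card_pathPos_eq_le a.2.le b.2.le
    _ = ∑ a : Fin T, 2 ^ T * ∑ b ∈ Finset.range T, (√((Nat.dist a b : ℕ) + 1))⁻¹ := by
        refine Finset.sum_congr rfl fun a _ => ?_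
        rw [← Finset.mul_sum, Finset.sum_range]
    _ ≤ ∑ a : Fin T, 2 ^ T * (2 * (2 * √T)) := by
        gcongr with a _
        refine (sum_dist_le (g := fun m => (√((m : ℝ) + 1))⁻¹) (fun m => by positivity)
          a.2).trans ?_
        gcongr
        exact sum_inv_sqrt_le T
    _ = _ := by
        rw [hsqrt]
        simp [T]
        ring

theorem card_mul_le_sum {α : Type*} [Fintype α] (f : α → ℝ) (hf : ∀ a, 0 ≤ f a) (c : ℝ)
    (p : α → Prop) [DecidablePred p] (hp : ∀ a, p a → c ≤ f a) :
    ((Finset.univ.filter p).card : ℝ) * c ≤ ∑ a, f a := by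
  rw [← nsmul_eq_mul]
  refine (Finset.card_nsmul_le_sum _ f c fun a ha => hp a (Finset.mem_filter.1 ha).2).trans ?_
  exact Finset.sum_le_sum_of_subset_of_nonneg (Finset.filter_subset _ _) fun a _ _ => hf a

theorem card_selfIntersections_gt_le (R : ℕ) (hR : 0 < R) :
    4 * (Finset.univ.filter fun x : Fin (R * R) → Bool =>
      16 * R ^ 3 < selfIntersections x).card ≤ 2 ^ (R * R) := by
  have h := (card_mul_le_sum (fun x : Fin (R * R) → Bool => (selfIntersections x : ℝ))
    (fun _ => by positivity) (16 * (R : ℝ) ^ 3) (fun x => 16 * R ^ 3 < selfIntersections x)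
    (fun x hx => by exact_mod_cast hx.le)).trans (sum_selfIntersections_le R)
  have hR' : (0 : ℝ) < 4 * (R : ℝ) ^ 3 := by positivity
  have : (4 : ℝ) * (Finset.univ.filter fun x : Fin (R * R) → Bool =>
      16 * R ^ 3 < selfIntersections x).card ≤ 2 ^ (R * R) :=
    le_of_mul_le_mul_right (by linarith) hR'
  exact_mod_cast this

/-- The number of times before `N` spent at distance more than `m` from the starting point. -/
def timeOutside {N : ℕ} (x : Fin N → Bool) (m : ℕ) : ℕ :=
  (Finset.univ.filter fun i : Fin N => (m : ℤ) < |pathPos x i|).card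

/-- Chebyshev and then Markov: the second moment of each position is at most `R²`, so the mean time
spent beyond `4R` is at most `R²/16`, a quarter of the threshold `R²/4`. -/
theorem card_timeOutside_gt_le (R : ℕ) (hR : 0 < R) :
    4 * (Finset.univ.filter fun x : Fin (R * R) → Bool =>
      R ^ 2 < 4 * timeOutside x (4 * R)).card ≤ 2 ^ (R * R) := by
  set T := R * R
  have hR' : (0 : ℝ) < R := by exact_mod_cast hR
  have hpt : ∀ x : Fin T → Bool, (timeOutside x (4 * R) : ℝ) * (16 * (R : ℝ) ^ 2) ≤
      ∑ i : Fin T, (pathPos x i : ℝ) ^ 2 := by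
    intro x
    refine card_mul_le_sum (fun i : Fin T => (pathPos x i : ℝ) ^ 2) (fun _ => by positivity) _ _ ?_
    intro i hi
    have hi' : (4 * R : ℝ) < |(pathPos x i : ℝ)| := by exact_mod_cast hi
    rw [← sq_abs (pathPos x i : ℝ)]
    nlinarith
  have hsum : ∑ x : Fin T → Bool, ∑ i : Fin T, (pathPos x i : ℝ) ^ 2 ≤ 2 ^ T * (R : ℝ) ^ 4 := by
    rw [Finset.sum_comm]
    calc ∑ i : Fin T, ∑ x : Fin T → Bool, (pathPos x i : ℝ) ^ 2
        = ∑ i : Fin T, 2 ^ T * (i : ℝ) := by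
          refine Finset.sum_congr rfl fun i _ => ?_
          exact_mod_cast sum_sq_pathPos (N := T) i.2.le
      _ ≤ ∑ i : Fin T, 2 ^ T * (T : ℝ) := by
          gcongr with i _
          exact i.2.le
      _ = _ := by simp [T]; ring
  have h := card_mul_le_sum (fun x : Fin T → Bool => (timeOutside x (4 * R) : ℝ))
    (fun _ => by positivity) ((R : ℝ) ^ 2 / 4) (fun x => R ^ 2 < 4 * timeOutside x (4 * R))
    (fun x hx => by
      have : (R : ℝ) ^ 2 < 4 * timeOutside x (4 * R) := by exact_mod_cast hx
      linarith)
  have h2 : (∑ x : Fin T → Bool, (timeOutside x (4 * R) : ℝ)) * (16 * (R : ℝ) ^ 2) ≤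
      2 ^ T * (R : ℝ) ^ 4 := by
    rw [Finset.sum_mul]
    exact (Finset.sum_le_sum fun x _ => hpt x).trans hsum
  have : (4 : ℝ) * (Finset.univ.filter fun x : Fin T → Bool =>
      R ^ 2 < 4 * timeOutside x (4 * R)).card ≤ 2 ^ T := by
    refine le_of_mul_le_mul_right (a := (R : ℝ) ^ 4) ?_ (by positivity)
    refine le_trans ?_ h2
    have := mul_le_mul_of_nonneg_right h (by positivity : (0 : ℝ) ≤ 16 * (R : ℝ) ^ 2)
    refine le_trans (le_of_eq ?_) this
    ring
  exact_mod_cast this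

/-- At least `R / 64` sites are visited at least `R / 36` times each. -/
def ManyHeavySites {N : ℕ} (R : ℕ) (x : Fin N → Bool) : Prop :=
  ∃ J : Finset ℤ, R ≤ 64 * J.card ∧ ∀ j ∈ J, R ≤ 36 * localTime x j

theorem sum_localTime_sq_le {N : ℕ} (x : Fin N → Bool) (J : Finset ℤ) :
    ∑ j ∈ J, localTime x j ^ 2 ≤ selfIntersections x := by
  have h : ∀ j ∈ J, localTime x j ^ 2 =
      ∑ i with pathPos x (i : Fin N) = j, localTime x (pathPos x i) := by
    intro j _
    rw [Finset.sum_congr rfl fun i hi => by rw [(Finset.mem_filter.1 hi).2]]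
    rw [Finset.sum_const, smul_eq_mul, sq]
    rfl
  rw [Finset.sum_congr rfl h]
  simp only [Finset.sum_filter]
  rw [Finset.sum_comm, selfIntersections]
  refine Finset.sum_le_sum fun i _ => ?_
  rw [Finset.sum_ite_eq]
  split_ifs <;> simp

theorem manyHeavySites_of_bounds {R : ℕ} (hR : 0 < R) (x : Fin (R * R) → Bool)
    (h1 : selfIntersections x ≤ 16 * R ^ 3) (h2 : 4 * timeOutside x (4 * R) ≤ R ^ 2) :
    ManyHeavySites R x := by
  set I := Finset.Icc (-(4 * R : ℤ)) (4 * R)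
  set J := I.filter fun j => R ≤ 36 * localTime x j with hJ
  refine ⟨J, ?_, fun j hj => (Finset.mem_filter.1 hj).2⟩
  have hI : I.card = 8 * R + 1 := by
    simp only [I, Int.card_Icc]; omega
  have hinside : ∑ j ∈ I, localTime x j + timeOutside x (4 * R) = R * R := by
    have : ∑ j ∈ I, localTime x j =
        (Finset.univ.filter fun i : Fin (R * R) => ¬ ((4 * R : ℕ) : ℤ) < |pathPos x i|).card := by
      rw [Finset.card_eq_sum_card_fiberwise (f := fun i : Fin (R * R) => pathPos x i) (t := I)]
      · refine Finset.sum_congr rfl fun j hj => ?_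
        rw [localTime, Finset.filter_filter]
        congr 1
        refine Finset.filter_congr fun i _ => ⟨fun h => ⟨?_, h⟩, fun h => h.2⟩
        rw [h, not_lt, abs_le]
        simpa [I] using hj
      · intro i hi
        simp only [Finset.coe_filter, Finset.mem_univ, true_and, Set.mem_ofPred_eq, not_lt,
          abs_le] at hi
        simpa [I] using hi
    rw [this, timeOutside, add_comm, Finset.card_filter_add_card_filter_not]
    simp
  have hsplit : ∑ j ∈ J, localTime x j + ∑ j ∈ I with ¬ R ≤ 36 * localTime x j, localTime x j =
      ∑ j ∈ I, localTime x j := Finset.sum_filter_add_sum_filter_not _ _ _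
  -- The at most `8R + 1 ≤ 9R` light sites absorb at most `R²/4` of the time. Another `R²/4` at most
  -- is spent outside `I`, so the heavy sites keep `R²/2`.
  have hlight : 36 * ∑ j ∈ I with ¬ R ≤ 36 * localTime x j, localTime x j ≤ (8 * R + 1) * R := by
    rw [Finset.mul_sum, ← hI]
    refine (Finset.sum_le_card_nsmul _ _ R fun j hj => ?_).trans ?_
    · have := (Finset.mem_filter.1 hj).2
      omega
    · rw [smul_eq_mul]
      gcongr
      exact Finset.filter_subset _ _
  have hheavy : R * R ≤ 2 * ∑ j ∈ J, localTime x j := by nlinarith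
  -- Cauchy–Schwarz: `(R²/2)² ≤ |J| · 16R³` forces `|J| ≥ R/64`.
  have hcs : (∑ j ∈ J, localTime x j) ^ 2 ≤ J.card * ∑ j ∈ J, localTime x j ^ 2 :=
    sq_sum_le_card_mul_sum_sq
  have hsq := sum_localTime_sq_le x J
  have : (R * R) * (R * R) ≤ 64 * J.card * R ^ 3 := by
    calc (R * R) * (R * R) ≤ (2 * ∑ j ∈ J, localTime x j) * (2 * ∑ j ∈ J, localTime x j) :=
          Nat.mul_le_mul hheavy hheavy
      _ = 4 * (∑ j ∈ J, localTime x j) ^ 2 := by ring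
      _ ≤ 4 * (J.card * (16 * R ^ 3)) := by
          gcongr
          exact hcs.trans (by gcongr; exact hsq.trans h1)
      _ = _ := by ring
  refine le_of_mul_le_mul_right (a := R ^ 3) ?_ (by positivity)
  linarith [this, (by ring : (R * R) * (R * R) = R * R ^ 3)]

open Classical in
theorem card_not_manyHeavySites_le (R : ℕ) (hR : 0 < R) :
    2 * (Finset.univ.filter fun x : Fin (R * R) → Bool => ¬ ManyHeavySites R x).card ≤
      2 ^ (R * R) := by
  have h1 := card_selfIntersections_gt_le R hR
  have h2 := card_timeOutside_gt_le R hR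
  have hsub : (Finset.univ.filter fun x : Fin (R * R) → Bool => ¬ ManyHeavySites R x) ⊆
      (Finset.univ.filter fun x : Fin (R * R) → Bool => 16 * R ^ 3 < selfIntersections x) ∪
      (Finset.univ.filter fun x : Fin (R * R) → Bool => R ^ 2 < 4 * timeOutside x (4 * R)) := by
    intro x hx
    simp only [Finset.mem_union, Finset.mem_filter, Finset.mem_univ, true_and] at hx ⊢
    by_contra! h
    exact hx (manyHeavySites_of_bounds hR x h.1 h.2)
  have := (Finset.card_le_card hsub).trans (Finset.card_union_le _ _)
  omega

/-! ### Decomposition into blocks -/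

/-- The increments of `x` at the times `m, …, m + T - 1`. -/
def pathBlock {N : ℕ} (x : Fin N → Bool) (T m : ℕ) : Fin T → Bool :=
  fun i => if h : m + i < N then x ⟨m + i, h⟩ else false

theorem pathPos_add {N T m : ℕ} (x : Fin N → Bool) (h : m + T ≤ N) {i : ℕ} (hi : i ≤ T) :
    pathPos x (m + i) = pathPos x m + pathPos (pathBlock x T m) i := by
  rw [pathPos, Finset.sum_range_add]
  congr 1
  refine Finset.sum_congr rfl fun j hj => ?_
  have hj := Finset.mem_range.1 hj
  simp [pathStep, pathBlock, show m + j < N by omega, show j < T by omega]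

theorem localTime_pathBlock_le {N T m : ℕ} (x : Fin N → Bool) (h : m + T ≤ N) (j : ℤ) :
    localTime (pathBlock x T m) j ≤ localTime x (j + pathPos x m) := by
  refine Finset.card_le_card_of_injOn (fun i => ⟨m + i, by omega⟩) ?_ ?_
  · intro i hi
    simp only [Finset.coe_filter, Finset.mem_univ, true_and, Set.mem_ofPred_eq] at hi ⊢
    rw [pathPos_add x h i.2.le, hi, add_comm]
  · intro i _ k _ hik
    simp only [Fin.mk.injEq] at hik
    omega

/-- Translating by the position at the start of the block matches the sites, and visits outside the
block only increase local times. -/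
theorem ManyHeavySites.of_pathBlock {N T m R : ℕ} {x : Fin N → Bool} (h : m + T ≤ N)
    (hx : ManyHeavySites R (pathBlock x T m)) : ManyHeavySites R x := by
  obtain ⟨J, hJ, hJ'⟩ := hx
  refine ⟨J.map (addRightEmbedding (pathPos x m)), by rwa [Finset.card_map], fun j hj => ?_⟩
  obtain ⟨k, hk, rfl⟩ := Finset.mem_map.1 hj
  exact (hJ' k hk).trans (Nat.mul_le_mul_left _ (localTime_pathBlock_le x h k))

theorem card_forall_pathBlock_le {N T K : ℕ} (hN : K * T ≤ N) (B : Finset (Fin T → Bool)) :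
    (Finset.univ.filter fun x : Fin N → Bool => ∀ k : Fin K, pathBlock x T (k * T) ∈ B).card ≤
      B.card ^ K * 2 ^ (N - K * T) := by
  have hcard : B.card ^ K * 2 ^ (N - K * T) =
      (Fintype.piFinset (fun _ : Fin K => B) ×ˢ
        (Finset.univ : Finset (Fin (N - K * T) → Bool))).card := by
    simp
  rw [hcard]
  refine Finset.card_le_card_of_injOn
    (fun x => (fun k => pathBlock x T (k * T), pathBlock x (N - K * T) (K * T))) ?_ ?_
  · intro x hx
    simpa using hx
  · intro x _ y _ hxy
    simp only [Prod.mk.injEq, funext_iff] at hxy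
    funext i
    by_cases hi : (i : ℕ) < K * T
    · have hT : 0 < T := Nat.pos_of_ne_zero fun h => by simp [h] at hi
      have := hxy.1 ⟨i / T, (Nat.div_lt_iff_lt_mul hT).2 hi⟩ ⟨i % T, Nat.mod_lt _ hT⟩
      simpa [pathBlock, Nat.div_add_mod'] using this
    · have hlt := i.2
      have := hxy.2 ⟨i - K * T, by omega⟩
      simpa [pathBlock, Nat.add_sub_cancel' (not_lt.1 hi)] using this

open Classical in
-- A path without many heavy sites has none of its `K` disjoint blocks with many heavy sites; each
-- block fails with probability at most `1/2`, independently.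
theorem card_not_manyHeavySites_mul_le {N R K : ℕ} (hR : 0 < R) (hN : K * (R * R) ≤ N) :
    (Finset.univ.filter fun x : Fin N → Bool => ¬ ManyHeavySites R x).card * 2 ^ K ≤ 2 ^ N := by
  set B := Finset.univ.filter fun x : Fin (R * R) → Bool => ¬ ManyHeavySites R x
  have hsub : (Finset.univ.filter fun x : Fin N → Bool => ¬ ManyHeavySites R x) ⊆
      Finset.univ.filter fun x : Fin N → Bool =>
        ∀ k : Fin K, pathBlock x (R * R) (k * (R * R)) ∈ B := by
    intro x hx
    simp only [B, Finset.mem_filter, Finset.mem_univ, true_and] at hx ⊢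
    intro k hk
    refine hx (hk.of_pathBlock (le_trans ?_ hN))
    rw [← Nat.succ_mul]
    exact Nat.mul_le_mul_right _ k.2
  calc _ ≤ (B.card ^ K * 2 ^ (N - K * (R * R))) * 2 ^ K := by
        gcongr
        exact (Finset.card_le_card hsub).trans (card_forall_pathBlock_le hN B)
    _ = (2 * B.card) ^ K * 2 ^ (N - K * (R * R)) := by rw [mul_pow]; ring
    _ ≤ (2 ^ (R * R)) ^ K * 2 ^ (N - K * (R * R)) := by
        gcongr
        exact card_not_manyHeavySites_le R hR
    _ = 2 ^ N := by
        rw [← pow_mul, ← pow_add, mul_comm (R * R) K, Nat.add_sub_cancel' hN]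

/-- At every visited site of `x`, the signs `y` used at the visits to that site sum to `0`. -/
def SiteSumsVanish {N : ℕ} (x y : Fin N → Bool) : Prop :=
  ∀ k : Fin N, ∑ i with pathPos x (i : Fin N) = pathPos x k, boolSign (y i) = 0

open Classical in
theorem card_siteSumsVanish_le {N R : ℕ} (hR : 36 ≤ R) {x : Fin N → Bool}
    (hx : ManyHeavySites R x) :
    ((Finset.univ.filter fun y : Fin N → Bool => SiteSumsVanish x y).card : ℝ) ≤
      2 ^ N * ((R : ℝ) / 36) ^ (-(R : ℝ) / 128) := by
  obtain ⟨J, hJ, hJ'⟩ := hx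
  have h := card_fiber_sums_eq_zero_le fun i : Fin N => pathPos x i
  rw [Fintype.card_fin] at h
  have h0 : (1 : ℝ) ≤ (R : ℝ) / 36 := by
    rw [le_div_iff₀ (by norm_num)]
    exact_mod_cast (by omega : 1 * 36 ≤ R)
  have hsub : J ⊆ Finset.univ.image fun i : Fin N => pathPos x i := by
    intro j hj
    have : 0 < localTime x j := by
      have := hJ' j hj
      omega
    obtain ⟨i, hi⟩ := Finset.card_pos.1 this
    exact Finset.mem_image.2 ⟨i, Finset.mem_univ _, (Finset.mem_filter.1 hi).2⟩
  have hprod : ∏ j ∈ Finset.univ.image (fun i : Fin N => pathPos x i),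
      (√((Finset.univ.filter fun i : Fin N => pathPos x i = j).card + 1))⁻¹ ≤
      ((R : ℝ) / 36) ^ (-(R : ℝ) / 128) := by
    -- Factors outside `J` are at most `1`. Each of the at least `R/64` remaining ones is at most
    -- `(R/36) ^ (-1/2)`, giving the exponent `-R/128`.
    calc _ ≤ ∏ j ∈ J, (√((Finset.univ.filter fun i : Fin N => pathPos x i = j).card + 1))⁻¹ := by
          refine Finset.prod_le_prod_of_subset_of_le_one hsub (fun _ _ => by positivity)
            fun j _ _ => inv_le_one_of_one_le₀ ?_
          rw [Real.one_le_sqrt]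
          linarith [Nat.cast_nonneg (α := ℝ) (Finset.univ.filter fun i : Fin N => pathPos x i = j).card]
      _ ≤ ∏ j ∈ J, ((R : ℝ) / 36) ^ (-(1 / 2) : ℝ) := by
          refine Finset.prod_le_prod (fun _ _ => by positivity) fun j hj => ?_
          rw [Real.rpow_neg (by positivity), ← Real.sqrt_eq_rpow]
          gcongr
          have : (R : ℝ) ≤ 36 * (localTime x j : ℝ) := by exact_mod_cast hJ' j hj
          rw [localTime] at this
          linarith
      _ = ((R : ℝ) / 36) ^ (-(1 / 2) * (J.card : ℝ) : ℝ) := by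
          rw [Finset.prod_const, Real.rpow_mul (by positivity), Real.rpow_natCast]
      _ ≤ _ := by
          refine Real.rpow_le_rpow_of_exponent_le h0 ?_
          have : (R : ℝ) ≤ 64 * (J.card : ℝ) := by exact_mod_cast hJ
          linarith
  refine le_trans (le_of_eq ?_) (h.trans (mul_le_mul_of_nonneg_left hprod (by positivity)))
  unfold SiteSumsVanish
  congr!

open Classical in
theorem card_pairs_siteSumsVanish_le {N R K : ℕ} (hR : 36 ≤ R) (hN : K * (R * R) ≤ N) :
    ((Finset.univ.filter fun p : (Fin N → Bool) × (Fin N → Bool) =>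
        SiteSumsVanish p.1 p.2).card : ℝ) ≤
      4 ^ N * ((1 / 2) ^ K + ((R : ℝ) / 36) ^ (-(R : ℝ) / 128)) := by
  set q := ((R : ℝ) / 36) ^ (-(R : ℝ) / 128)
  have hq : 0 ≤ q := by positivity
  have hbad : ((Finset.univ.filter fun x : Fin N → Bool => ¬ ManyHeavySites R x).card : ℝ) ≤
      2 ^ N * (1 / 2) ^ K := by
    have : ((Finset.univ.filter fun x : Fin N → Bool => ¬ ManyHeavySites R x).card : ℝ) * 2 ^ K ≤
        2 ^ N := by exact_mod_cast card_not_manyHeavySites_mul_le (by omega) hN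
    rwa [one_div, inv_pow, ← div_eq_mul_inv, le_div_iff₀ (by positivity)]
  have hcard : ((Finset.univ.filter fun p : (Fin N → Bool) × (Fin N → Bool) =>
        SiteSumsVanish p.1 p.2).card : ℝ) =
      ∑ x : Fin N → Bool,
        ((Finset.univ.filter fun y : Fin N → Bool => SiteSumsVanish x y).card : ℝ) := by
    simp only [Finset.card_filter, Nat.cast_sum]
    rw [Fintype.sum_prod_type]
  have hpt : ∀ x : Fin N → Bool,
      ((Finset.univ.filter fun y : Fin N → Bool => SiteSumsVanish x y).card : ℝ) ≤
        2 ^ N * q + 2 ^ N * (if ¬ ManyHeavySites R x then 1 else 0) := by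
    intro x
    by_cases hx : ManyHeavySites R x
    · simpa [hx] using card_siteSumsVanish_le hR hx
    · have : (Finset.univ.filter fun y : Fin N → Bool => SiteSumsVanish x y).card ≤ 2 ^ N := by
        refine (Finset.card_le_univ _).trans (by simp)
      have : ((Finset.univ.filter fun y : Fin N → Bool => SiteSumsVanish x y).card : ℝ) ≤
        2 ^ N := by exact_mod_cast this
      simp only [hx, not_false_eq_true, if_true, mul_one]
      have : 0 ≤ (2 : ℝ) ^ N * q := by positivity
      linarith
  rw [hcard]
  refine (Finset.sum_le_sum fun x _ => hpt x).trans ?_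
  rw [Finset.sum_add_distrib, ← Finset.mul_sum Finset.univ (fun x : Fin N → Bool =>
    if ¬ ManyHeavySites R x then (1 : ℝ) else 0) ((2 : ℝ) ^ N), ← Finset.natCast_card_filter]
  have h4 : (4 : ℝ) ^ N = 2 ^ N * 2 ^ N := by rw [← mul_pow]; norm_num
  have : (2 : ℝ) ^ N * ((Finset.univ.filter fun x : Fin N → Bool => ¬ ManyHeavySites R x).card : ℝ)
      ≤ 2 ^ N * (2 ^ N * (1 / 2) ^ K) := by gcongr
  rw [Finset.sum_const, nsmul_eq_mul, Finset.card_univ, Fintype.card_fun, Fintype.card_bool,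
    Fintype.card_fin, h4]
  push_cast
  linarith

/-! ### The walk in coordinates -/

theorem affElt_mul (s b s' b' : ℝ) :
    affElt s b * affElt s' b' = affElt (s + s') (b + b' * Real.exp s) := by
  ext i j
  fin_cases i <;> fin_cases j <;>
    simp [affElt, Matrix.mul_apply, Fin.sum_univ_two, Real.exp_add, mul_comm, add_comm]

theorem affElt_zero : affElt 0 0 = 1 := by
  ext i j
  fin_cases i <;> fin_cases j <;> simp [affElt]

theorem snd_eq_zero_of_affElt_eq_one {s b : ℝ} (h : affElt s b = 1) : b = 0 := by
  have := congrArg (fun g : GL (Fin 2) ℝ => g 0 1) h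
  simpa [affElt] using this

theorem affElt_mem_affSubgroup {ε a b : ℝ} (ha : a = 1 ∨ a = -1) (hb : b = 1 ∨ b = -1) :
    affElt (ε * a) (ε * b) ∈ affSubgroup ε := by
  have h1 : affElt ε 0 ∈ affSubgroup ε := Subgroup.subset_closure (by simp)
  have h2 : affElt 0 ε ∈ affSubgroup ε := Subgroup.subset_closure (by simp)
  have h1' : affElt (-ε) 0 ∈ affSubgroup ε := by
    have : affElt (-ε) 0 = (affElt ε 0)⁻¹ :=
      eq_inv_of_mul_eq_one_left (by rw [affElt_mul]; simp [affElt_zero])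
    exact this ▸ inv_mem h1
  have h2' : affElt 0 (-ε) ∈ affSubgroup ε := by
    have : affElt 0 (-ε) = (affElt 0 ε)⁻¹ :=
      eq_inv_of_mul_eq_one_left (by rw [affElt_mul]; simp [affElt_zero])
    exact this ▸ inv_mem h2
  have hsplit : affElt (ε * a) (ε * b) = affElt 0 (ε * b) * affElt (ε * a) 0 := by
    rw [affElt_mul]; simp
  rw [hsplit]
  refine mul_mem ?_ ?_
  · rcases hb with rfl | rfl <;> simpa
  · rcases ha with rfl | rfl <;> simpa

theorem affWalk_eq {Ω : Type*} (ε : ℝ) (X Y : ℕ → Ω → ℝ) (n : ℕ) (ω : Ω) :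
    affWalk ε X Y n ω = affElt (ε * ∑ i ∈ Finset.range n, X i ω)
      (∑ k ∈ Finset.range n, ε * Y k ω * Real.exp (ε * ∑ i ∈ Finset.range k, X i ω)) := by
  induction n with
  | zero => simp [affWalk, affElt_zero]
  | succ n ih =>
    rw [affWalk, ih, affElt_mul, Finset.sum_range_succ, Finset.sum_range_succ, mul_add]

theorem Transcendental.fiber_sums_eq_zero {ι : Type*} [Fintype ι] {t : ℝ}
    (ht : Transcendental ℚ t) (f : ι → ℤ) (c : ι → ℤ)
    (h : ∑ k, (c k : ℝ) * t ^ f k = 0) (k₀ : ι) : ∑ k with f k = f k₀, c k = 0 := by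
  have ht0 : t ≠ 0 := by
    rintro rfl
    exact ht isAlgebraic_zero
  -- Multiplying by `t ^ M` clears the negative exponents, leaving a genuine polynomial whose
  -- coefficients are the fibre sums.
  obtain ⟨M, hM⟩ : ∃ M : ℕ, ∀ k, 0 ≤ f k + M := by
    refine ⟨∑ k, (f k).natAbs, fun k => ?_⟩
    have := Finset.single_le_sum (f := fun k => (f k).natAbs) (fun _ _ => Nat.zero_le _)
      (Finset.mem_univ k)
    omega
  let p : Polynomial ℚ := ∑ k, Polynomial.C (c k : ℚ) * Polynomial.X ^ (f k + M).toNat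
  have hp : Polynomial.aeval t p = 0 := by
    have : Polynomial.aeval t p = (∑ k, (c k : ℝ) * t ^ f k) * t ^ M := by
      simp only [p, map_sum, map_mul, map_pow, Polynomial.aeval_C, Polynomial.aeval_X,
        Finset.sum_mul]
      refine Finset.sum_congr rfl fun k _ => ?_
      rw [mul_assoc, ← zpow_natCast t M, ← zpow_add₀ ht0, ← zpow_natCast,
        Int.toNat_of_nonneg (hM k)]
      simp
    rw [this, h, zero_mul]
  have hp0 : p = 0 := (transcendental_iff.1 ht) p hp
  have hc : p.coeff (f k₀ + M).toNat = ((∑ k with f k = f k₀, c k : ℤ) : ℚ) := by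
    simp only [p, Polynomial.finsetSum_coeff, Polynomial.coeff_C_mul, Polynomial.coeff_X_pow,
      Finset.sum_filter, Int.cast_sum]
    refine Finset.sum_congr rfl fun k _ => ?_
    have hiff : (f k₀ + M).toNat = (f k + M).toNat ↔ f k = f k₀ := by
      have := hM k
      have := hM k₀
      omega
    simp only [hiff]
    split_ifs <;> simp
  rw [hp0, Polynomial.coeff_zero] at hc
  exact_mod_cast hc.symm

theorem siteSumsVanish_of_affWalk_eq_one {Ω : Type*} {ε : ℝ}
    (hε : Transcendental ℚ (Real.exp ε)) {X Y : ℕ → Ω → ℝ} {N : ℕ} {ω : Ω}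
    {x y : Fin N → Bool} (hx : ∀ i < N, X i ω = pathStep x i) (hy : ∀ i < N, Y i ω = pathStep y i)
    (h : affWalk ε X Y N ω = 1) : SiteSumsVanish x y := by
  rw [affWalk_eq] at h
  have hε0 : ε ≠ 0 := by
    rintro rfl
    rw [Real.exp_zero] at hε
    exact hε isAlgebraic_one
  have hb := snd_eq_zero_of_affElt_eq_one h
  have hsum : ∑ k ∈ Finset.range N,
      ε * Y k ω * Real.exp (ε * ∑ i ∈ Finset.range k, X i ω) =
      ε * ∑ k : Fin N, ((boolSign (y k) : ℤ) : ℝ) * Real.exp ε ^ pathPos x k := by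
    rw [Finset.sum_range, Finset.mul_sum]
    refine Finset.sum_congr rfl fun k _ => ?_
    have hS : ∑ i ∈ Finset.range k, X i ω = (pathPos x k : ℝ) := by
      rw [pathPos, Int.cast_sum]
      exact Finset.sum_congr rfl fun i hi => hx i ((Finset.mem_range.1 hi).trans k.2)
    rw [hS, hy k k.2, Real.exp_mul, Real.rpow_intCast, mul_assoc]
    simp [pathStep]
  rw [hsum] at hb
  exact hε.fiber_sums_eq_zero (fun k : Fin N => pathPos x k) _
    ((mul_eq_zero.1 hb).resolve_left hε0)

/-! ### The law of the innovations -/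

theorem ae_eq_one_or_eq_neg_one {Ω : Type*} [MeasurableSpace Ω] {P : Measure Ω}
    [IsProbabilityMeasure P] {Z : Ω → ℝ} (hZ : Measurable Z) (h1 : P {ω | Z ω = 1} = 1 / 2)
    (h2 : P {ω | Z ω = -1} = 1 / 2) : ∀ᵐ ω ∂P, Z ω = 1 ∨ Z ω = -1 := by
  have hm1 : MeasurableSet {ω | Z ω = 1} := hZ (measurableSet_singleton 1)
  have hm2 : MeasurableSet {ω | Z ω = -1} := hZ (measurableSet_singleton (-1))
  have hu : P ({ω | Z ω = 1} ∪ {ω | Z ω = -1}) = 1 := by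
    rw [measure_union _ hm2, h1, h2, ENNReal.add_halves]
    rw [Set.disjoint_left]
    intro ω h h'
    simp only [Set.mem_ofPred_eq] at h h'
    linarith
  have := (prob_compl_eq_zero_iff (hm1.union hm2)).2 hu
  exact this

namespace IsBernoulliPair

variable {Ω : Type*} [MeasurableSpace Ω] {P : Measure Ω} {X Y : ℕ → Ω → ℝ}

theorem ae_sign [IsProbabilityMeasure P] (h : IsBernoulliPair P X Y) :
    ∀ᵐ ω ∂P, ∀ i, (X i ω = 1 ∨ X i ω = -1) ∧ (Y i ω = 1 ∨ Y i ω = -1) :=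
  ae_all_iff.2 fun i =>
    (ae_eq_one_or_eq_neg_one (h.measurable_X i) (h.X_pos i) (h.X_neg i)).and
      (ae_eq_one_or_eq_neg_one (h.measurable_Y i) (h.Y_pos i) (h.Y_neg i))

theorem ae_affWalk_mem [IsProbabilityMeasure P] (h : IsBernoulliPair P X Y) (ε : ℝ) :
    ∀ᵐ ω ∂P, ∀ n, affWalk ε X Y n ω ∈ affSubgroup ε := by
  filter_upwards [h.ae_sign] with ω hω n
  induction n with
  | zero => exact one_mem _
  | succ n ih => exact mul_mem ih (affElt_mem_affSubgroup (hω n).1 (hω n).2)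

theorem measure_cylinder (h : IsBernoulliPair P X Y) {N : ℕ} (x y : Fin N → Bool) :
    P {ω | ∀ i < N, X i ω = pathStep x i ∧ Y i ω = pathStep y i} = ((4 : ENNReal) ^ N)⁻¹ := by
  have hset : {ω | ∀ i < N, X i ω = pathStep x i ∧ Y i ω = pathStep y i} =
      ⋂ i ∈ (Finset.range N).disjSum (Finset.range N),
        Sum.elim X Y i ⁻¹' {((Sum.elim (pathStep x) (pathStep y) i : ℤ) : ℝ)} := by
    ext ω
    simp only [Set.mem_ofPred_eq, Set.mem_iInter, Set.mem_preimage, Set.mem_singleton_iff,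
      Sum.forall, Finset.inl_mem_disjSum, Finset.inr_mem_disjSum, Finset.mem_range, Sum.elim_inl,
      Sum.elim_inr]
    exact ⟨fun H => ⟨fun i hi => (H i hi).1, fun i hi => (H i hi).2⟩,
      fun H i hi => ⟨H.1 i hi, H.2 i hi⟩⟩
  have hX : ∀ i ∈ Finset.range N, P (X i ⁻¹' {((pathStep x i : ℤ) : ℝ)}) = 2⁻¹ := by
    intro i hi
    rw [pathStep, dif_pos (Finset.mem_range.1 hi), ← one_div]
    cases x ⟨i, Finset.mem_range.1 hi⟩
    · convert h.X_neg i using 2; ext ω; simp [boolSign]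
    · convert h.X_pos i using 2; ext ω; simp [boolSign]
  have hY : ∀ i ∈ Finset.range N, P (Y i ⁻¹' {((pathStep y i : ℤ) : ℝ)}) = 2⁻¹ := by
    intro i hi
    rw [pathStep, dif_pos (Finset.mem_range.1 hi), ← one_div]
    cases y ⟨i, Finset.mem_range.1 hi⟩
    · convert h.Y_neg i using 2; ext ω; simp [boolSign]
    · convert h.Y_pos i using 2; ext ω; simp [boolSign]
  rw [hset, h.indep.measure_inter_preimage_eq_mul _ fun i _ => measurableSet_singleton _,
    Finset.prod_disjSum]
  simp only [Sum.elim_inl, Sum.elim_inr]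
  rw [Finset.prod_congr rfl hX, Finset.prod_congr rfl hY, Finset.prod_const, Finset.card_range,
    ← mul_pow, ← ENNReal.mul_inv (by simp) (by simp), ← ENNReal.inv_pow]
  norm_num

open Classical in
-- Almost surely all innovations are signs, so the return event is covered by the cylinders of the
-- admissible sign pairs, each of mass `4 ^ (-N)`.
theorem returnProb_le [IsProbabilityMeasure P] (h : IsBernoulliPair P X Y) {ε : ℝ}
    (hε : Transcendental ℚ (Real.exp ε)) (N : ℕ) :
    returnProb P ε X Y N ≤
      (Finset.univ.filter fun p : (Fin N → Bool) × (Fin N → Bool) =>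
        SiteSumsVanish p.1 p.2).card / 4 ^ N := by
  set B := Finset.univ.filter fun p : (Fin N → Bool) × (Fin N → Bool) => SiteSumsVanish p.1 p.2
  have hle : P {ω | affWalk ε X Y N ω = 1} ≤
      P (⋃ p ∈ B, {ω | ∀ i < N, X i ω = pathStep p.1 i ∧ Y i ω = pathStep p.2 i}) := by
    refine measure_mono_ae ?_
    filter_upwards [h.ae_sign] with ω hω hret
    have hbit : ∀ {a : ℝ}, a = 1 ∨ a = -1 → a = (boolSign (decide (a = 1)) : ℤ) := by
      rintro a (rfl | rfl)
      · simp [boolSign]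
      · have : ¬ (-1 : ℝ) = 1 := by norm_num
        simp [boolSign, this]
    have hx : ∀ i < N, X i ω = pathStep (fun i : Fin N => decide (X i ω = 1)) i := by
      intro i hi
      rw [pathStep, dif_pos hi]
      exact hbit (hω i).1
    have hy : ∀ i < N, Y i ω = pathStep (fun i : Fin N => decide (Y i ω = 1)) i := by
      intro i hi
      rw [pathStep, dif_pos hi]
      exact hbit (hω i).2
    refine Set.mem_biUnion (x := (_, _)) (Finset.mem_coe.2 ?_) fun i hi => ⟨hx i hi, hy i hi⟩
    exact Finset.mem_filter.2
      ⟨Finset.mem_univ _, siteSumsVanish_of_affWalk_eq_one hε hx hy hret⟩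
  have hle' : P {ω | affWalk ε X Y N ω = 1} ≤ B.card * ((4 : ENNReal) ^ N)⁻¹ := by
    refine hle.trans ((measure_biUnion_finset_le _ _).trans (le_of_eq ?_))
    rw [Finset.sum_congr rfl fun p _ => h.measure_cylinder p.1 p.2, Finset.sum_const,
      nsmul_eq_mul]
  rw [returnProb, measureReal_def]
  refine (ENNReal.toReal_mono ?_ hle').trans (le_of_eq ?_)
  · exact ENNReal.mul_ne_top (by simp) (by simp)
  · simp [div_eq_mul_inv]

end IsBernoulliPair

/-! ### Choice of the block length -/

theorem block_bound_le_exp {n R : ℕ} {u : ℝ} (hn : 1 < n) (hu : 1 ≤ u) (huR : u ≤ R)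
    (hRu : (R : ℝ) ≤ 2 * u) (hu3 : u ^ 3 * Real.log n = n) (hbig : (n : ℝ) ^ (1 / 4 : ℝ) * 36 ≤ u)
    (hlarge : 2048 ≤ u * Real.log n) :
    (1 / 2 : ℝ) ^ (2 * n / (R * R)) + ((R : ℝ) / 36) ^ (-(R : ℝ) / 128) ≤
      Real.exp (-(1024⁻¹ * (u * Real.log n))) := by
  set l := Real.log n with hl
  have hn' : (1 : ℝ) < n := by exact_mod_cast hn
  have hl0 : 0 < l := Real.log_pos hn'
  have hR : (0 : ℝ) < R := by linarith
  have hRn : 0 < R := by exact_mod_cast hR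
  have h1 : (1 / 2 : ℝ) ^ (2 * n / (R * R)) ≤ 2 * Real.exp (-(u * l / 512)) := by
    set K := 2 * n / (R * R)
    have hK : 2 * n < (K + 1) * (R * R) := by
      rw [mul_comm (K + 1)]
      exact Nat.lt_mul_div_succ _ (Nat.mul_pos hRn hRn)
    have hK' : (2 * n : ℝ) < (K + 1) * (R * R) := by exact_mod_cast hK
    -- From `R² ≤ 4u²` and `n = u³ l`, the quotient `2n/R²` is at least `u l / 2`. The floor costs
    -- the `+ 1`, paid for by the factor `2` in `h1`.
    have hK2 : u * l / 2 ≤ K + 1 := by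
      have : (R * R : ℝ) ≤ 4 * u ^ 2 := by nlinarith
      have h3 : (2 * n : ℝ) ≤ (K + 1) * (4 * u ^ 2) :=
        hK'.le.trans (mul_le_mul_of_nonneg_left this (by positivity))
      rw [← hu3] at h3
      refine le_of_mul_le_mul_right (a := 4 * u ^ 2) ?_ (by positivity)
      linarith [(by ring : u * l / 2 * (4 * u ^ 2) = 2 * (u ^ 3 * l))]
    -- A deliberately weak rate, chosen to give the same exponent `u l / 512` as the second term.
    have hhalf : (1 / 2 : ℝ) ≤ Real.exp (-(1 / 256)) := by
      have := Real.add_one_le_exp (-(1 / 256 : ℝ))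
      linarith
    have : (1 / 2 : ℝ) ^ (K + 1) ≤ Real.exp (-(u * l / 512)) := by
      calc (1 / 2 : ℝ) ^ (K + 1) ≤ Real.exp (-(1 / 256)) ^ (K + 1) := by gcongr
        _ = Real.exp ((K + 1 : ℕ) * (-(1 / 256))) := (Real.exp_nat_mul _ _).symm
        _ ≤ _ := by
          rw [Real.exp_le_exp]
          push_cast
          linarith
    rw [pow_succ] at this
    linarith
  have h2 : ((R : ℝ) / 36) ^ (-(R : ℝ) / 128) ≤ Real.exp (-(u * l / 512)) := by
    have hq : (n : ℝ) ^ (1 / 4 : ℝ) ≤ R / 36 := by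
      rw [le_div_iff₀ (by norm_num)]
      linarith
    have hlog : l / 4 ≤ Real.log (R / 36) := by
      have := Real.log_le_log (by positivity) hq
      rw [Real.log_rpow (by linarith)] at this
      linarith
    rw [Real.rpow_def_of_pos (by positivity), Real.exp_le_exp]
    have : u * (l / 4) ≤ R * Real.log (R / 36) := by gcongr
    linarith
  -- Half of the exponent absorbs the constant `3 = 2 + 1`; this uses `u l ≥ 2048` and produces the
  -- final `1024`.
  have h3 : (3 : ℝ) ≤ Real.exp (u * l / 1024) := by
    have := Real.add_one_le_exp (u * l / 1024)
    linarith
  calc _ ≤ 3 * Real.exp (-(u * l / 512)) := by linarith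
    _ ≤ Real.exp (u * l / 1024) * Real.exp (-(u * l / 512)) := by gcongr
    _ = _ := by
      rw [← Real.exp_add]
      ring_nf

/-- The lower bound `36 n ^ (1/4)` on the scale makes `log (R/36)` at least `(log n) / 4`. After
cubing it amounts to `36³ log n ≤ n ^ (1/4)`. -/
theorem eventually_scale_bounds :
    ∀ᶠ n : ℕ in Filter.atTop, 1 < n ∧
      (n : ℝ) ^ (1 / 4 : ℝ) * 36 ≤ ((n : ℝ) / Real.log n) ^ (1 / 3 : ℝ) ∧ 2048 ≤ Real.log n ∧
      36 ≤ ((n : ℝ) / Real.log n) ^ (1 / 3 : ℝ) := by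
  have hlog : Filter.Tendsto (fun n : ℕ => Real.log n) Filter.atTop Filter.atTop :=
    Real.tendsto_log_atTop.comp tendsto_natCast_atTop_atTop
  have ho : ∀ᶠ n : ℕ in Filter.atTop,
      ‖Real.log n‖ ≤ (1 / 36 ^ 3) * ‖(n : ℝ) ^ (1 / 4 : ℝ)‖ :=
    tendsto_natCast_atTop_atTop.eventually
      ((isLittleO_log_rpow_atTop (by norm_num : (0 : ℝ) < 1 / 4)).def (by norm_num))
  filter_upwards [Filter.eventually_gt_atTop 1, hlog.eventually_ge_atTop 2048, ho]
    with n hn hl ho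
  have hn' : (1 : ℝ) < n := by exact_mod_cast hn
  have hl0 : 0 < Real.log n := by linarith
  have hpos : (0 : ℝ) < (n : ℝ) ^ (1 / 4 : ℝ) := by positivity
  rw [Real.norm_of_nonneg hl0.le, Real.norm_of_nonneg hpos.le] at ho
  have key : (n : ℝ) ^ (1 / 4 : ℝ) * 36 ≤ ((n : ℝ) / Real.log n) ^ (1 / 3 : ℝ) := by
    have hcube : ((n : ℝ) ^ (1 / 4 : ℝ) * 36) ^ 3 ≤ (n : ℝ) / Real.log n := by
      have hfour : ((n : ℝ) ^ (1 / 4 : ℝ)) ^ 4 = n := by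
        rw [← Real.rpow_natCast, ← Real.rpow_mul (by positivity)]
        norm_num
      rw [le_div_iff₀ hl0]
      calc ((n : ℝ) ^ (1 / 4 : ℝ) * 36) ^ 3 * Real.log n
          ≤ ((n : ℝ) ^ (1 / 4 : ℝ) * 36) ^ 3 * (1 / 36 ^ 3 * (n : ℝ) ^ (1 / 4 : ℝ)) := by gcongr
        _ = ((n : ℝ) ^ (1 / 4 : ℝ)) ^ 4 := by ring
        _ = n := hfour
    calc (n : ℝ) ^ (1 / 4 : ℝ) * 36
        = (((n : ℝ) ^ (1 / 4 : ℝ) * 36) ^ 3) ^ (1 / 3 : ℝ) := by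
          rw [← Real.rpow_natCast, ← Real.rpow_mul (by positivity)]
          norm_num
      _ ≤ _ := Real.rpow_le_rpow (by positivity) hcube (by norm_num)
  refine ⟨hn, key, hl, le_trans ?_ key⟩
  have : (1 : ℝ) ≤ (n : ℝ) ^ (1 / 4 : ℝ) := Real.one_le_rpow hn'.le (by norm_num)
  linarith

theorem proposition3p2 :
    ∃ c : ℝ, 1 ≤ c ∧ ∃ N : ℕ, ∀ ε : ℝ, Transcendental ℚ (Real.exp ε) →
      ∀ (Ω : Type*) [MeasurableSpace Ω] (P : Measure Ω) [IsProbabilityMeasure P]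
        (X Y : ℕ → Ω → ℝ), IsBernoulliPair P X Y →
        (∀ᵐ ω ∂P, ∀ n : ℕ, affWalk ε X Y n ω ∈ affSubgroup ε) ∧
        ∀ n : ℕ, N ≤ n →
          returnProb P ε X Y (2 * n) ≤
            Real.exp (-(c⁻¹ * (n : ℝ) ^ (1 / 3 : ℝ) * Real.log n ^ (2 / 3 : ℝ))) := by
  obtain ⟨N, hN⟩ := Filter.eventually_atTop.1 eventually_scale_bounds
  refine ⟨1024, by norm_num, N, fun ε hε Ω _ P _ X Y h => ⟨h.ae_affWalk_mem ε, fun n hn => ?_⟩⟩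
  obtain ⟨hn1, hbig, hlog, hu⟩ := hN n hn
  set u := ((n : ℝ) / Real.log n) ^ (1 / 3 : ℝ) with hudef
  set R := ⌈u⌉₊
  have hl0 : 0 < Real.log n := by linarith
  have huR : u ≤ R := Nat.le_ceil u
  have hRu : (R : ℝ) ≤ 2 * u := by
    have := Nat.ceil_lt_add_one (by linarith : 0 ≤ u)
    linarith
  have hR36 : 36 ≤ R := by exact_mod_cast hu.trans huR
  have hu3 : u ^ 3 * Real.log n = n := by
    rw [hudef, ← Real.rpow_natCast, ← Real.rpow_mul (by positivity)]
    norm_num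
    field_simp
  -- At the balancing scale `u = (n / log n) ^ (1/3)`, the target exponent is exactly `u log n`.
  have hul : (n : ℝ) ^ (1 / 3 : ℝ) * Real.log n ^ (2 / 3 : ℝ) = u * Real.log n := by
    rw [hudef, Real.div_rpow (by positivity) hl0.le, div_mul_eq_mul_div, mul_div_assoc]
    congr 1
    rw [eq_div_iff (by positivity), ← Real.rpow_add hl0]
    norm_num
  have hcount := card_pairs_siteSumsVanish_le hR36 (Nat.div_mul_le_self (2 * n) (R * R))
  refine (h.returnProb_le hε (2 * n)).trans ?_
  rw [mul_assoc, hul]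
  refine le_trans ?_ (block_bound_le_exp hn1 (by linarith) huR hRu hu3 hbig (by nlinarith))
  rw [div_le_iff₀' (by positivity)]
  exact hcount
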